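/- A unital locally $C^*$-algebra is a complete Hausdorff unital complex topological $*$-algebra $\mathcal A$ whose topology is determined by an upward directed family $\{p_\lambda\}_{\lambda\in\Lambda}$ of $C^*$-seminorms, i.e. seminorms with $p_\lambda(ab)\le p_\lambda(a)p_\lambda(b)$ and $p_\lambda(a^*a)=p_\lambda(a)^2$. For $m\in\mathbb N$, $M_m(\mathcal A)\cong\mathcal A\otimes M_m(\mathbb C)$ is a locally $C^*$-algebra with the $C^*$-seminorms $p_\lambda^m([a_{ij}])=\|[\pi_\lambda(a_{ij})]\|_{M_m(\mathcal A_\lambda)}$, where $\pi_\lambda$ is the canonical map of $\mathcal A$ onto the $C^*$-algebra $\mathcal A_\lambda=\mathcal A/\ker p_\lambda$. For $a\in\mathcal A$, write $a=_\lambda 0$ if $p_\lambda(a)=0$, and $a\ge_\lambda 0$ if $a=b^*b+c$ for some $b,c\in\mathcal A$ with $p_\lambda(c)=0$; the same notation is used in $M_m(\mathcal A)$ with $p_\lambda^m$ in place of $p_\lambda$. Let $\mathcal A$ and $\mathcal B$ be unital locally $C^*$-algebras with families of $C^*$-seminorms $\{p_\lambda\}_{\lambda\in\Lambda}$ and $\{q_\delta\}_{\delta\in\Delta}$.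 A linear map $\varphi:\mathcal A\to\mathcal B$ is local completely positive (respectively, local completely copositive) if for each $\delta\in\Delta$ there is $\lambda\in\Lambda$ such that for all $m\in\mathbb N$ and all $[a_{ij}]\in M_m(\mathcal A)$, with $x=[\varphi(a_{ij})]$ (respectively, $x=[\varphi(a_{ji})]$): $[a_{ij}]\ge_\lambda 0$ implies $x\ge_\delta 0$, and $[a_{ij}]=_\lambda 0$ implies $x=_\delta 0$. A linear map is local decomposable if it is the sum of a local completely positive linear map and a local completely copositive linear map. Theorem. Let $\mathcal A$ and $\mathcal B$ be unital locally $C^*$-algebras and let $\varphi:\mathcal A\to\mathcal B$ be a linear map. If for some $n\ge 2$ the map $\varphi\otimes\mathrm{id}_{M_n(\mathbb C)}:\mathcal A\otimes M_n(\mathbb C)\to\mathcal B\otimes M_n(\mathbb C)$ is local decomposable, then $\varphi$ is local completely positive. -/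

import Mathlib

open scoped TensorProduct

noncomputable section

namespace LocallyCStar

/-- A `C*`-seminorm on a unital complex `*`-algebra. -/
structure CStarSeminorm (A : Type*) [Ring A] [StarRing A] [Algebra ℂ A] extends
    Seminorm ℂ A where
  mul_le' : ∀ a b : A, toFun (a * b) ≤ toFun a * toFun b
  star_mul_self' : ∀ a : A, toFun (star a * a) = toFun a ^ 2

namespace CStarSeminorm

variable {A : Type*} [Ring A] [StarRing A] [Algebra ℂ A]

instance : CoeFun (CStarSeminorm A) (fun _ => A → ℝ) := ⟨fun p => p.toSeminorm⟩

theorem mul_le (p : CStarSeminorm A) (a b : A) : p (a * b) ≤ p a * p b := p.mul_le' a b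

theorem star_mul_self (p : CStarSeminorm A) (a : A) : p (star a * a) = p a ^ 2 :=
  p.star_mul_self' a

theorem le_star (p : CStarSeminorm A) (a : A) : p a ≤ p (star a) := by
  have h := p.mul_le (star a) a
  rw [p.star_mul_self, sq] at h
  rcases (apply_nonneg p.toSeminorm a).eq_or_lt with h0 | h0
  · rw [← h0]
    exact apply_nonneg p.toSeminorm _
  · exact le_of_mul_le_mul_right h h0

theorem map_star (p : CStarSeminorm A) (a : A) : p (star a) = p a :=
  le_antisymm (by simpa using p.le_star (star a)) (p.le_star a)

/-- A copy of `A`, seminormed by `p`. -/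
def Carrier (_p : CStarSeminorm A) : Type _ := A

instance (p : CStarSeminorm A) : Ring p.Carrier := inferInstanceAs (Ring A)

instance (p : CStarSeminorm A) : SeminormedRing p.Carrier where
  norm a := p (show A from a)
  dist a b := p (-(show A from a) + show A from b)
  dist_self a := by
    rw [neg_add_cancel]
    exact map_zero p.toSeminorm
  dist_comm a b := by
    rw [← map_neg_eq_map p.toSeminorm]
    congr 1
    abel
  dist_triangle a b c := by
    refine le_trans (le_of_eq ?_) (map_add_le_add p.toSeminorm _ _)
    congr 1
    abel
  dist_eq a b := rfl
  norm_mul_le a b := p.mul_le a b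

instance (p : CStarSeminorm A) : Algebra ℂ p.Carrier := inferInstanceAs (Algebra ℂ A)

instance (p : CStarSeminorm A) : NormedAlgebra ℂ p.Carrier where
  norm_smul_le c a := (map_smul_eq_mul p.toSeminorm c (show A from a)).le

instance (p : CStarSeminorm A) : StarRing p.Carrier := inferInstanceAs (StarRing A)

instance (p : CStarSeminorm A) : NormedStarGroup p.Carrier where
  norm_star_le a := (p.map_star a).le

/-- The `C*`-algebra `A_p` attached to the `C*`-seminorm `p`: the Hausdorff completion of
`(A, p)`, that is, the completion of `A / ker p` in the norm induced by `p`. (When `p` is a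
continuous `C*`-seminorm on a locally `C*`-algebra, `A / ker p` is already complete.) -/
def QuotAlg (p : CStarSeminorm A) : Type _ := UniformSpace.Completion p.Carrier

instance (p : CStarSeminorm A) : NormedRing p.QuotAlg :=
  inferInstanceAs (NormedRing (UniformSpace.Completion p.Carrier))

instance (p : CStarSeminorm A) : CompleteSpace p.QuotAlg :=
  inferInstanceAs (CompleteSpace (UniformSpace.Completion p.Carrier))

instance (p : CStarSeminorm A) : Algebra ℂ p.QuotAlg :=
  inferInstanceAs (Algebra ℂ (UniformSpace.Completion p.Carrier))

instance (p : CStarSeminorm A) : NormedAlgebra ℂ p.QuotAlg where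
  norm_smul_le c a := norm_smul_le c (show UniformSpace.Completion p.Carrier from a)

/-- The canonical map `π_p : A → A_p`. -/
def toQuot (p : CStarSeminorm A) : A →ₐ[ℂ] p.QuotAlg where
  toFun a := ((show p.Carrier from a : p.Carrier) : UniformSpace.Completion p.Carrier)
  map_one' := UniformSpace.Completion.coe_one _
  map_mul' a b := UniformSpace.Completion.coe_mul (α := p.Carrier) a b
  map_zero' := UniformSpace.Completion.coe_zero
  map_add' a b := UniformSpace.Completion.coe_add (α := p.Carrier) a b
  commutes' _ := rfl

theorem norm_toQuot (p : CStarSeminorm A) (a : A) : ‖p.toQuot a‖ = p a :=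
  UniformSpace.Completion.norm_coe (E := p.Carrier) a

theorem denseRange_toQuot (p : CStarSeminorm A) : DenseRange p.toQuot :=
  UniformSpace.Completion.denseRange_coe (α := p.Carrier)

instance (p : CStarSeminorm A) : Star p.QuotAlg where
  star := UniformSpace.Completion.map (star : p.Carrier → p.Carrier)

theorem uniformContinuous_star (p : CStarSeminorm A) :
    UniformContinuous (star : p.Carrier → p.Carrier) :=
  (AddMonoidHomClass.isometry_of_norm (starAddEquiv : p.Carrier ≃+ p.Carrier)
    (fun a => norm_star a)).uniformContinuous

theorem continuous_star_quot (p : CStarSeminorm A) : Continuous (star : p.QuotAlg → p.QuotAlg) :=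
  UniformSpace.Completion.continuous_map

theorem toQuot_star (p : CStarSeminorm A) (a : A) : p.toQuot (star a) = star (p.toQuot a) :=
  (UniformSpace.Completion.map_coe p.uniformContinuous_star a).symm

instance (p : CStarSeminorm A) : StarRing p.QuotAlg where
  star_involutive x := by
    refine p.denseRange_toQuot.induction_on x
      (isClosed_eq (p.continuous_star_quot.comp p.continuous_star_quot) continuous_id) ?_
    intro a
    rw [← toQuot_star, ← toQuot_star, star_star]
  star_mul x y := by
    refine p.denseRange_toQuot.induction_on₂ (isClosed_eq
      (p.continuous_star_quot.comp continuous_mul)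
      ((p.continuous_star_quot.comp continuous_snd).mul
        (p.continuous_star_quot.comp continuous_fst))) ?_ x y
    intro a b
    rw [← map_mul, ← toQuot_star, ← toQuot_star, ← toQuot_star, star_mul, map_mul]
  star_add x y := by
    refine p.denseRange_toQuot.induction_on₂ (isClosed_eq
      (p.continuous_star_quot.comp continuous_add)
      ((p.continuous_star_quot.comp continuous_fst).add
        (p.continuous_star_quot.comp continuous_snd))) ?_ x y
    intro a b
    rw [← map_add, ← toQuot_star, ← toQuot_star, ← toQuot_star, star_add, map_add]

instance (p : CStarSeminorm A) : CStarRing p.QuotAlg where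
  norm_mul_self_le x := by
    refine p.denseRange_toQuot.induction_on x (isClosed_le (by fun_prop)
      ((p.continuous_star_quot.mul continuous_id).norm)) ?_
    intro a
    rw [← toQuot_star, ← map_mul, norm_toQuot, norm_toQuot, p.star_mul_self, sq]

instance [StarModule ℂ A] (p : CStarSeminorm A) : StarModule ℂ p.QuotAlg where
  star_smul c x := by
    refine p.denseRange_toQuot.induction_on x (isClosed_eq
      (p.continuous_star_quot.comp (continuous_const_smul c))
      (p.continuous_star_quot.const_smul (star c))) ?_
    intro a
    rw [← map_smul, ← toQuot_star, ← toQuot_star, star_smul, map_smul]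

variable [StarModule ℂ A]

instance (p : CStarSeminorm A) : CStarAlgebra p.QuotAlg where

instance (p : CStarSeminorm A) : PartialOrder p.QuotAlg := CStarAlgebra.spectralOrder _

instance (p : CStarSeminorm A) : StarOrderedRing p.QuotAlg := CStarAlgebra.spectralOrderedRing _

/-- The entrywise map `M_n(A) → M_n(A_p)` into the `C*`-algebra of matrices over `A_p`. -/
def matrixToQuot (p : CStarSeminorm A) (n : ℕ) :
    Matrix (Fin n) (Fin n) A →ₗ[ℂ] CStarMatrix (Fin n) (Fin n) p.QuotAlg where
  toFun a := CStarMatrix.ofMatrix (a.map p.toQuot)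
  map_add' a b := by ext i j; exact map_add p.toQuot _ _
  map_smul' c a := by ext i j; exact map_smul p.toQuot _ _

theorem matrixToQuot_mul (p : CStarSeminorm A) (n : ℕ) (a b : Matrix (Fin n) (Fin n) A) :
    p.matrixToQuot n (a * b) = p.matrixToQuot n a * p.matrixToQuot n b :=
  Matrix.map_mul (f := (p.toQuot : A →+* p.QuotAlg))

theorem matrixToQuot_star (p : CStarSeminorm A) (n : ℕ) (a : Matrix (Fin n) (Fin n) A) :
    p.matrixToQuot n (star a) = star (p.matrixToQuot n a) := by
  ext i j
  exact p.toQuot_star _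

/-- The `C*`-seminorm `pⁿ` on `M_n(A)`: `pⁿ([a_ij])` is the norm of `[π_p(a_ij)]` in the
`C*`-algebra `M_n(A_p)`. -/
def matrix (p : CStarSeminorm A) (n : ℕ) : CStarSeminorm (Matrix (Fin n) (Fin n) A) where
  toSeminorm := (normSeminorm ℂ (CStarMatrix (Fin n) (Fin n) p.QuotAlg)).comp (p.matrixToQuot n)
  mul_le' a b := by
    change ‖p.matrixToQuot n (a * b)‖ ≤ ‖p.matrixToQuot n a‖ * ‖p.matrixToQuot n b‖
    rw [matrixToQuot_mul]
    exact norm_mul_le _ _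
  star_mul_self' a := by
    change ‖p.matrixToQuot n (star a * a)‖ = ‖p.matrixToQuot n a‖ ^ 2
    rw [matrixToQuot_mul, matrixToQuot_star, CStarRing.norm_star_mul_self, sq]

end CStarSeminorm

/-- `A` is a (unital) locally `C*`-algebra whose topology is given by the family `p`: `A` is
Hausdorff and complete, and its topology is defined by the upward directed family `p` of
`C*`-seminorms. -/
structure IsLocallyCStarAlgebra {A : Type*} [Ring A] [StarRing A] [Algebra ℂ A]
    [UniformSpace A] [IsUniformAddGroup A] {Λ : Type*} (p : Λ → CStarSeminorm A) : Prop where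
  nonempty : Nonempty Λ
  directed : Directed (· ≤ ·) (fun l => (p l).toSeminorm)
  withSeminorms : WithSeminorms (fun l => (p l).toSeminorm)
  t2 : T2Space A
  complete : CompleteSpace A

/-- `a =_p 0`. -/
def EqZeroAt {A : Type*} [Ring A] [StarRing A] [Algebra ℂ A] (p : CStarSeminorm A)
    (a : A) : Prop :=
  p a = 0

/-- `a ≥_p 0`: `a = b* b + c` for some `b, c` with `p c = 0`. -/
def PosAt {A : Type*} [Ring A] [StarRing A] [Algebra ℂ A] (p : CStarSeminorm A)
    (a : A) : Prop :=
  ∃ b c : A, a = star b * b + c ∧ EqZeroAt p c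

section TensorId

variable {A B : Type*} [Ring A] [Algebra ℂ A] [Ring B] [Algebra ℂ B]

/-- The map `φ ⊗ id` from `A ⊗ M_n(ℂ)` to `B ⊗ M_n(ℂ)`, where `A ⊗ M_n(ℂ)` is identified with
the locally `C*`-algebra `M_n(A)` in the canonical way. -/
def tensorId (φ : A →ₗ[ℂ] B) (n : ℕ) :
    Matrix (Fin n) (Fin n) A →ₗ[ℂ] Matrix (Fin n) (Fin n) B :=
  (matrixEquivTensor (Fin n) ℂ B).symm.toLinearMap ∘ₗ
    TensorProduct.map φ (LinearMap.id : Matrix (Fin n) (Fin n) ℂ →ₗ[ℂ] _) ∘ₗ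
    (matrixEquivTensor (Fin n) ℂ A).toLinearMap

/-- Under the identification, `φ ⊗ id` acts entrywise. -/
theorem tensorId_apply (φ : A →ₗ[ℂ] B) (n : ℕ) (a : Matrix (Fin n) (Fin n) A) :
    tensorId φ n a = a.map φ := by
  apply (matrixEquivTensor (Fin n) ℂ B).injective
  simp [tensorId, matrixEquivTensor_apply]

end TensorId

section Maps

variable {A B : Type*} [Ring A] [StarRing A] [Algebra ℂ A] [StarModule ℂ A]
  [Ring B] [StarRing B] [Algebra ℂ B] [StarModule ℂ B]
  {Λ Δ : Type*}

/-- Local completely positive maps; `a.map φ = [φ(a_ij)]` is the amplification of `φ`. -/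
def IsLocalCP (p : Λ → CStarSeminorm A) (q : Δ → CStarSeminorm B) (φ : A →ₗ[ℂ] B) : Prop :=
  ∀ d : Δ, ∃ l : Λ, ∀ (n : ℕ) (a : Matrix (Fin n) (Fin n) A),
    (PosAt ((p l).matrix n) a → PosAt ((q d).matrix n) (a.map φ)) ∧
    (EqZeroAt ((p l).matrix n) a → EqZeroAt ((q d).matrix n) (a.map φ))

/-- Local completely copositive maps; `a.transpose.map φ = [φ(a_ji)]` is `(φ ⊗ t)(a)`. -/
def IsLocalCCoP (p : Λ → CStarSeminorm A) (q : Δ → CStarSeminorm B) (φ : A →ₗ[ℂ] B) : Prop :=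
  ∀ d : Δ, ∃ l : Λ, ∀ (n : ℕ) (a : Matrix (Fin n) (Fin n) A),
    (PosAt ((p l).matrix n) a → PosAt ((q d).matrix n) (a.transpose.map φ)) ∧
    (EqZeroAt ((p l).matrix n) a → EqZeroAt ((q d).matrix n) (a.transpose.map φ))

/-- Local decomposable maps. -/
def IsLocalDecomposable (p : Λ → CStarSeminorm A) (q : Δ → CStarSeminorm B)
    (φ : A →ₗ[ℂ] B) : Prop :=
  ∃ φ₁ φ₂ : A →ₗ[ℂ] B, IsLocalCP p q φ₁ ∧ IsLocalCCoP p q φ₂ ∧ φ = φ₁ + φ₂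

end Maps

end LocallyCStar

end

/-! Write φ ⊗ id = φ₁ + φ₂ and fix δ. Testing on the positive matrix [e_ij ⊗ b*b] gives Gram
representations of both summands in `B_δ`. Entries where φ ⊗ id vanishes on the diagonal kill Gram
vectors, which confines φ₁(e_ij ⊗ b*b) to entry (i, j) and φ₂(e_ij ⊗ b*b) to entry (j, i). For i ≠ j
the map φ ⊗ id has nothing at (j, i), so φ₂(e_ij ⊗ b*b) vanishes at δ. On the 2 × 2 all-ones block
tensored with b*b, which needs n ≥ 2, the vector (1, -1) annihilates the image under φ ⊗ id, hence
each positive summand; what survives of φ₂ is the sum of its two diagonal squares, so these vanish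
too (`toQuot_copositive_single_star_mul_self`). By polarization φ₂ vanishes at δ on the corner A ⊗
e_ii, so φ agrees there with a corner of φ₁. Compressing to a corner turns b*b into a sum of
squares; completeness makes it a single square modulo the null space of the seminorm
(`IsLocallyCStarAlgebra.posAt_sum_star_mul_self`). -/

namespace LocallyCStar

open Filter Topology Polynomial

/-! ### Square roots as limits of polynomials -/

section SquareRoot

/-- Polynomial approximations of the square root on `[0, R]` approximate the square root of a
positive element of norm at most `R`. -/
theorem norm_aeval_sub_sqrt_le {D : Type*} [CStarAlgebra D] [PartialOrder D] [StarOrderedRing D]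
    {s : D} (hs : 0 ≤ s) {P : ℝ[X]} {R ε : ℝ} (hR : ‖s‖ ≤ R) (hε : 0 ≤ ε)
    (hP : ∀ x ∈ Set.Icc 0 R, |P.eval x - √x| ≤ ε) :
    ‖aeval s (P.map (algebraMap ℝ ℂ)) - CFC.sqrt s‖ ≤ ε := by
  have hsa : IsSelfAdjoint s := .of_nonneg hs
  rw [aeval_map_algebraMap, CFC.sqrt_eq_real_sqrt s hs, cfcₙ_eq_cfc, ← cfc_polynomial P s hsa,
    ← cfc_sub _ _ s]
  refine norm_cfc_le hε fun x hx => hP x ⟨spectrum_nonneg_of_nonneg hs hx, ?_⟩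
  -- The bound |x| ≤ ‖s‖ on the spectrum uses ‖1‖ = 1; the zero algebra is excluded because its
  -- spectra are empty.
  have : Nontrivial D := by
    by_contra hD
    rw [not_nontrivial_iff_subsingleton] at hD
    simp [spectrum.of_subsingleton] at hx
  exact (Real.le_norm_self x).trans ((spectrum.norm_le_norm_of_mem hx).trans hR)

/-- A sequence of polynomials converging to the square root, uniformly on bounded subsets of
`[0, ∞)`. -/
theorem exists_polynomial_seq_near_sqrt :
    ∃ P : ℕ → ℝ[X], ∀ k : ℕ, ∀ x ∈ Set.Icc (0 : ℝ) k, |(P k).eval x - √x| ≤ 1 / ((k : ℝ) + 1) := by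
  have h (k : ℕ) := exists_polynomial_near_of_continuousOn 0 k Real.sqrt
    Real.continuous_sqrt.continuousOn (1 / ((k : ℝ) + 1)) (by positivity)
  choose P hP using h
  exact ⟨P, fun k x hx => (hP k x hx).le⟩

/-- The sequence `P` depends on neither `D` nor `s`, so one sequence of polynomials serves all the
algebras `B_δ` at once. -/
theorem exists_tendsto_aeval_sqrt {D : Type*} [CStarAlgebra D] [PartialOrder D]
    [StarOrderedRing D] {s : D} (hs : 0 ≤ s) {P : ℕ → ℝ[X]}
    (hP : ∀ k : ℕ, ∀ x ∈ Set.Icc (0 : ℝ) k, |(P k).eval x - √x| ≤ 1 / ((k : ℝ) + 1)) :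
    ∃ t : D, star t * t = s ∧
      Tendsto (fun k => aeval s ((P k).map (algebraMap ℝ ℂ))) atTop (𝓝 t) := by
  refine ⟨CFC.sqrt s, ?_, ?_⟩
  · rw [(IsSelfAdjoint.of_nonneg (CFC.sqrt_nonneg s)).star_eq, CFC.sqrt_mul_sqrt_self s hs]
  rw [tendsto_iff_norm_sub_tendsto_zero]
  refine squeeze_zero' (.of_forall fun _ => norm_nonneg _) ?_
    (tendsto_one_div_add_atTop_nhds_zero_nat (𝕜 := ℝ))
  filter_upwards [eventually_ge_atTop ⌈‖s‖⌉₊] with k hk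
  exact norm_aeval_sub_sqrt_le hs (Nat.ceil_le.mp hk) (by positivity) (hP k)

end SquareRoot

namespace CStarSeminorm

variable {A : Type*} [Ring A] [StarRing A] [Algebra ℂ A] [StarModule ℂ A]

/-- `matrixToQuot` as an algebra homomorphism. -/
noncomputable def matrixToQuotAlgHom (p : CStarSeminorm A) (n : ℕ) :
    Matrix (Fin n) (Fin n) A →ₐ[ℂ] CStarMatrix (Fin n) (Fin n) p.QuotAlg :=
  AlgHom.ofLinearMap (p.matrixToQuot n)
    (Matrix.map_one p.toQuot (map_zero _) (map_one _)) (p.matrixToQuot_mul n)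

theorem toQuot_eq_zero_iff (p : CStarSeminorm A) {a : A} : p.toQuot a = 0 ↔ p a = 0 := by
  rw [← norm_toQuot, norm_eq_zero]

theorem matrix_eq_zero_iff (p : CStarSeminorm A) {n : ℕ} {a : Matrix (Fin n) (Fin n) A} :
    p.matrix n a = 0 ↔ ∀ i j, p (a i j) = 0 := by
  change ‖p.matrixToQuot n a‖ = 0 ↔ _
  rw [norm_eq_zero, ← CStarMatrix.ext_iff]
  exact forall₂_congr fun i j => p.toQuot_eq_zero_iff

end CStarSeminorm

theorem eqZeroAt_sub_of_toQuot_eq {A : Type*} [Ring A] [StarRing A] [Algebra ℂ A] [StarModule ℂ A]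
    {p : CStarSeminorm A} {n : ℕ} {a b : Matrix (Fin n) (Fin n) A}
    (h : p.matrixToQuot n a = p.matrixToQuot n b) : EqZeroAt (p.matrix n) (a - b) := by
  change ‖p.matrixToQuot n (a - b)‖ = 0
  rw [map_sub, h, sub_self, norm_zero]

/-! ### Convergence in all seminorms, and sums of squares -/

section Locally

variable {B : Type*} [Ring B] [StarRing B] [Algebra ℂ B] [UniformSpace B] [IsUniformAddGroup B]
  {Δ : Type*} {q : Δ → CStarSeminorm B}

theorem IsLocallyCStarAlgebra.tendsto_toQuot (hB : IsLocallyCStarAlgebra q) (d : Δ) {u : ℕ → B}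
    {b : B} (h : Tendsto u atTop (𝓝 b)) :
    Tendsto (fun k => (q d).toQuot (u k)) atTop (𝓝 ((q d).toQuot b)) := by
  have : Nonempty Δ := hB.nonempty
  rw [tendsto_iff_norm_sub_tendsto_zero]
  simp_rw [← map_sub, CStarSeminorm.norm_toQuot]
  rw [hB.withSeminorms.tendsto_nhds] at h
  rw [Metric.tendsto_nhds]
  intro ε hε
  filter_upwards [h d ε hε] with k hk
  rw [Real.dist_eq, sub_zero, abs_of_nonneg (apply_nonneg (q d).toSeminorm _)]
  exact hk

/-- Convergence in each completion makes the sequence Cauchy for each seminorm, hence Cauchy in `B`.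
The limits `t` need not be known to come from `B`. -/
theorem IsLocallyCStarAlgebra.exists_tendsto (hB : IsLocallyCStarAlgebra q) {u : ℕ → B}
    (h : ∀ d, ∃ t, Tendsto (fun k => (q d).toQuot (u k)) atTop (𝓝 t)) :
    ∃ b, Tendsto u atTop (𝓝 b) := by
  have : Nonempty Δ := hB.nonempty
  have := hB.complete
  refine cauchySeq_tendsto_of_complete ?_
  rw [cauchySeq_iff_tendsto, uniformity_eq_comap_nhds_zero, tendsto_comap_iff,
    hB.withSeminorms.tendsto_nhds]
  intro d ε hε
  obtain ⟨t, ht⟩ := h d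
  obtain ⟨N, hN⟩ := Metric.cauchySeq_iff.mp ht.cauchySeq ε hε
  filter_upwards [eventually_ge_atTop (N, N)] with k hk
  have := hN k.2 hk.2 k.1 hk.1
  rw [dist_eq_norm, ← map_sub, CStarSeminorm.norm_toQuot] at this
  simpa using this

variable [StarModule ℂ B]

/-- In `M_m(B)`, a finite sum of elements `y* y` is again of this form, up to an element on which
the seminorm vanishes. -/
theorem IsLocallyCStarAlgebra.posAt_sum_star_mul_self (hB : IsLocallyCStarAlgebra q) (d : Δ)
    {m : ℕ} {ι : Type*} (S : Finset ι) (y : ι → Matrix (Fin m) (Fin m) B) :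
    PosAt ((q d).matrix m) (∑ k ∈ S, star (y k) * y k) := by
  set s := ∑ k ∈ S, star (y k) * y k with hs
  have hpos (d : Δ) : 0 ≤ (q d).matrixToQuot m s := by
    rw [hs, map_sum]
    refine Finset.sum_nonneg fun k _ => ?_
    rw [CStarSeminorm.matrixToQuot_mul, CStarSeminorm.matrixToQuot_star]
    exact star_mul_self_nonneg _
  obtain ⟨P, hP⟩ := exists_polynomial_seq_near_sqrt
  -- The polynomials are evaluated in M_m(B) itself, before passing to any quotient, so the
  -- entrywise limit of `x` is a common lift of the square roots at every δ.
  let x (k : ℕ) : Matrix (Fin m) (Fin m) B := aeval s ((P k).map (algebraMap ℝ ℂ))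
  choose t ht hlim using fun d => exists_tendsto_aeval_sqrt (hpos d) hP
  have hx (d : Δ) : Tendsto (fun k => (q d).matrixToQuot m (x k)) atTop (𝓝 (t d)) := by
    refine (hlim d).congr fun k => ?_
    exact aeval_algHom_apply ((q d).matrixToQuotAlgHom m) s _
  have hentry (d : Δ) (i j : Fin m) : Tendsto (fun k => (q d).toQuot (x k i j)) atTop
      (𝓝 (t d i j)) :=
    tendsto_pi_nhds.mp (tendsto_pi_nhds.mp (hx d) i) j
  choose u hu using fun i j => hB.exists_tendsto fun d => ⟨_, hentry d i j⟩
  have hsqrt : (q d).matrixToQuot m (Matrix.of u) = t d := by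
    ext i j
    exact tendsto_nhds_unique (hB.tendsto_toQuot d (hu i j)) (hentry d i j)
  refine ⟨Matrix.of u, s - star (Matrix.of u) * Matrix.of u, (add_sub_cancel _ _).symm,
    eqZeroAt_sub_of_toQuot_eq ?_⟩
  rw [CStarSeminorm.matrixToQuot_mul, CStarSeminorm.matrixToQuot_star, hsqrt, ht]

end Locally

section Basic

variable {A : Type*} [Ring A] [StarRing A] [Algebra ℂ A]

theorem posAt_star_mul_self (p : CStarSeminorm A) (b : A) : PosAt p (star b * b) :=
  ⟨b, 0, (add_zero _).symm, map_zero p.toSeminorm⟩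

theorem EqZeroAt.add {p : CStarSeminorm A} {a b : A} (ha : EqZeroAt p a) (hb : EqZeroAt p b) :
    EqZeroAt p (a + b) := by
  refine le_antisymm ((map_add_le_add p.toSeminorm a b).trans ?_) (apply_nonneg p.toSeminorm _)
  exact (add_eq_zero_iff_of_nonneg (apply_nonneg p.toSeminorm a)
    (apply_nonneg p.toSeminorm b)).mpr ⟨ha, hb⟩ |>.le

theorem PosAt.add_eqZeroAt {p : CStarSeminorm A} {a c : A} (ha : PosAt p a) (hc : EqZeroAt p c) :
    PosAt p (a + c) := by
  obtain ⟨b, c', rfl, hc'⟩ := ha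
  exact ⟨b, c' + c, add_assoc _ _ _, hc'.add hc⟩

end Basic

/-! ### Gram representations of positive matrices -/

section Gram

variable {B : Type*} [Ring B] [StarRing B] [Algebra ℂ B] [StarModule ℂ B]

/-- The image of a positive element of `M_m(M_n(B))` is a Gram matrix with entries in `B_q`. -/
theorem PosAt.exists_gram {q : CStarSeminorm B} {n m : ℕ}
    {x : Matrix (Fin m) (Fin m) (Matrix (Fin n) (Fin n) B)} (h : PosAt ((q.matrix n).matrix m) x) :
    ∃ v : Fin m → Fin n → Fin m × Fin n → q.QuotAlg, ∀ i j k l,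
      q.toQuot (x i j k l) = ∑ t, star (v i k t) * v j l t := by
  obtain ⟨b, c, rfl, hc⟩ := h
  refine ⟨fun i k t => q.toQuot (b t.1 i t.2 k), fun i j k l => ?_⟩
  have hc' : q.toQuot (c i j k l) = 0 := by
    rw [q.toQuot_eq_zero_iff]
    exact q.matrix_eq_zero_iff.mp ((q.matrix n).matrix_eq_zero_iff.mp hc i j) k l
  rw [Matrix.add_apply, Matrix.add_apply, map_add, hc', add_zero, Matrix.mul_apply,
    Matrix.sum_apply, map_sum, Fintype.sum_prod_type]
  refine Finset.sum_congr rfl fun s _ => ?_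
  rw [Matrix.mul_apply, map_sum]
  refine Finset.sum_congr rfl fun r _ => ?_
  rw [map_mul, Matrix.star_apply, Matrix.star_apply, CStarSeminorm.toQuot_star]

theorem eq_zero_of_sum_star_mul_self_add {R ι κ : Type*} [CStarAlgebra R] [PartialOrder R]
    [StarOrderedRing R] [Fintype ι] [Fintype κ] {v : ι → R} {w : κ → R}
    (h : ∑ t, star (v t) * v t + ∑ t, star (w t) * w t = 0) : v = 0 ∧ w = 0 := by
  have hv : 0 ≤ ∑ t, star (v t) * v t := Finset.sum_nonneg fun t _ => star_mul_self_nonneg _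
  have hw : 0 ≤ ∑ t, star (w t) * w t := Finset.sum_nonneg fun t _ => star_mul_self_nonneg _
  obtain ⟨h1, h2⟩ := (add_eq_zero_iff_of_nonneg hv hw).mp h
  rw [Finset.sum_eq_zero_iff_of_nonneg fun t _ => star_mul_self_nonneg _] at h1 h2
  exact ⟨funext fun t => CStarRing.star_mul_self_eq_zero_iff _ |>.mp (h1 t (Finset.mem_univ t)),
    funext fun t => CStarRing.star_mul_self_eq_zero_iff _ |>.mp (h2 t (Finset.mem_univ t))⟩

end Gram

/-! ### Vanishing of the copositive summand -/

section Decomposition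

variable {A B : Type*} [Ring A] [StarRing A] [Algebra ℂ A] [StarModule ℂ A]
  [Ring B] [StarRing B] [Algebra ℂ B] [StarModule ℂ B] {Λ Δ : Type*}
  {p : Λ → CStarSeminorm A} {q : Δ → CStarSeminorm B}

/-- The square root has a single nonzero row, with entries e_{i₀j} ⊗ b, since e_{i₀i}* e_{i₀j} =
e_ij. The choice of `i₀` is immaterial. -/
theorem posAt_single_single (p : CStarSeminorm A) {n : ℕ} (i₀ : Fin n) (b : A) :
    PosAt ((p.matrix n).matrix n)
      (Matrix.of fun i j : Fin n => Matrix.single i j (star b * b)) := by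
  convert posAt_star_mul_self ((p.matrix n).matrix n)
    (Matrix.of fun l j : Fin n => if l = i₀ then Matrix.single i₀ j b else 0) using 1
  ext1 i j
  rw [Matrix.mul_apply, Finset.sum_eq_single i₀ (fun l _ hl => by simp [hl])
    (fun h => absurd (Finset.mem_univ _) h)]
  simp [Matrix.star_apply, Matrix.star_eq_conjTranspose]

theorem posAt_single_add_single (p : CStarSeminorm A) {n : ℕ} (i j : Fin n) (b : A) :
    PosAt ((p.matrix n).matrix 1) (Matrix.of fun _ _ : Fin 1 =>
      Matrix.single i i (star b * b) + Matrix.single i j (star b * b) +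
        (Matrix.single j i (star b * b) + Matrix.single j j (star b * b))) := by
  convert posAt_star_mul_self ((p.matrix n).matrix 1)
    (Matrix.of fun _ _ : Fin 1 => Matrix.single i i b + Matrix.single i j b) using 1
  ext1 k l
  simp [Matrix.mul_apply, Matrix.star_eq_conjTranspose, add_mul, mul_add]
  abel

/-- If `φ ⊗ id` is the sum of a local completely positive map and a local completely copositive
map, then the latter vanishes on the elements `b* b ⊗ e_ii`. -/
theorem toQuot_copositive_single_star_mul_self {n : ℕ} {φ : A →ₗ[ℂ] B}
    {φ₁ φ₂ : Matrix (Fin n) (Fin n) A →ₗ[ℂ] Matrix (Fin n) (Fin n) B}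
    (h₁ : IsLocalCP (fun l => (p l).matrix n) (fun d => (q d).matrix n) φ₁)
    (h₂ : IsLocalCCoP (fun l => (p l).matrix n) (fun d => (q d).matrix n) φ₂)
    (hφ : tensorId φ n = φ₁ + φ₂) (d : Δ) {i₀ i₁ : Fin n} (hi : i₀ ≠ i₁) (b : A) (k l : Fin n) :
    (q d).toQuot (φ₂ (Matrix.single i₀ i₀ (star b * b)) k l) = 0 := by
  obtain ⟨l₁, h₁⟩ := h₁ d
  obtain ⟨l₂, h₂⟩ := h₂ d
  obtain ⟨v, hv⟩ := ((h₁ n _).1 (posAt_single_single (p l₁) i₀ b)).exists_gram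
  obtain ⟨w, hw⟩ := ((h₂ n _).1 (posAt_single_single (p l₂) i₀ b)).exists_gram
  obtain ⟨v', hv'⟩ := ((h₁ 1 _).1 (posAt_single_add_single (p l₁) i₀ i₁ b)).exists_gram
  obtain ⟨w', hw'⟩ := ((h₂ 1 _).1 (posAt_single_add_single (p l₂) i₀ i₁ b)).exists_gram
  set a := star b * b
  set π := (q d).toQuot
  simp only [Matrix.map_apply, Matrix.transpose_apply, Matrix.of_apply] at hv hw hv' hw'
  have hsum (x : Matrix (Fin n) (Fin n) A) (k l : Fin n) :
      π (φ₁ x k l) + π (φ₂ x k l) = π (φ (x k l)) := by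
    rw [← map_add, ← Matrix.add_apply, ← LinearMap.add_apply, ← hφ, tensorId_apply,
      Matrix.map_apply]
  -- The two squares add up to the (k, k) entry of φ ⊗ id at e_ii ⊗ a, which is zero.
  have hcol (i k : Fin n) (hk : k ≠ i) : v i k = 0 ∧ w i k = 0 := by
    refine eq_zero_of_sum_star_mul_self_add ?_
    rw [← hv, ← hw, hsum]
    simp [hk.symm]
  have hanti (i j : Fin n) (hij : i ≠ j) : π (φ₂ (Matrix.single i j a) j i) = 0 := by
    have := hsum (Matrix.single i j a) j i
    simpa [hv, (hcol i j hij.symm).1, Matrix.single_apply, hij] using this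
  -- Copositivity swaps the indices: the entry is ∑ (w_jk)* w_il, and one factor vanishes by `hcol`.
  have hoff (i j k l : Fin n) (hij : k ≠ j ∨ l ≠ i) : π (φ₂ (Matrix.single i j a) k l) = 0 := by
    rw [hw]
    rcases hij with h | h
    · simp [(hcol _ _ h).2]
    · simp [(hcol _ _ h).2]
  -- Evaluation at the vector (1, -1): the four relevant entries of the image under φ ⊗ id all equal
  -- φ(a), so their alternating sum is zero.
  have hdiff : (fun t => v' 0 i₀ t - v' 0 i₁ t) = 0 ∧ (fun t => w' 0 i₀ t - w' 0 i₁ t) = 0 := by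
    refine eq_zero_of_sum_star_mul_self_add ?_
    simp only [star_sub, sub_mul, mul_sub, Finset.sum_sub_distrib, ← hv', ← hw']
    have e (k l : Fin n) := hsum (Matrix.single i₀ i₀ a + Matrix.single i₀ i₁ a +
        (Matrix.single i₁ i₀ a + Matrix.single i₁ i₁ a)) k l
    have e00 := e i₀ i₀
    have e01 := e i₀ i₁
    have e10 := e i₁ i₀
    have e11 := e i₁ i₁
    simp only [Matrix.add_apply, Matrix.single_apply, hi, hi.symm, and_self, and_true,
      and_false, if_true, if_false, add_zero, zero_add] at e00 e01 e10 e11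
    linear_combination (norm := abel) e00 - e01 - e10 + e11
  -- In the expanded alternating sum for φ₂, `hoff` and `hanti` remove every term except the two
  -- diagonal ones, which are the squares of these vectors.
  have hzero : w i₀ i₀ = 0 ∧ w i₁ i₁ = 0 := by
    refine eq_zero_of_sum_star_mul_self_add ?_
    have e : ∑ t, star (w' 0 i₀ t - w' 0 i₁ t) * (w' 0 i₀ t - w' 0 i₁ t) = 0 :=
      Finset.sum_eq_zero fun t _ => by rw [congrFun hdiff.2 t]; simp
    simp only [star_sub, sub_mul, mul_sub, Finset.sum_sub_distrib, ← hw', map_add,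
      Matrix.add_apply] at e
    rw [← hw, ← hw]
    simpa [hanti, hoff, hi, hi.symm] using e
  rw [hw]
  rcases eq_or_ne k i₀ with rfl | hk
  · simp [hzero.1]
  · simp [(hcol _ _ hk).2]

/-- Every element is a linear combination of elements `b* b`. -/
theorem linearMap_eq_zero_of_star_mul_self {M : Type*} [AddCommGroup M] [Module ℂ M]
    {f : A →ₗ[ℂ] M} (h : ∀ b, f (star b * b) = 0) : f = 0 := by
  ext a
  -- Polarization: 1 + a gives f(a*) = -f(a), and 1 + ia gives f(a*) = f(a).
  have h0 := h 1
  have ha := h a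
  have h1 := h (1 + a)
  have h2 := h (1 + Complex.I • a)
  simp only [star_add, star_one, star_smul, add_mul, mul_add, one_mul, mul_one, map_add, map_smul,
    smul_mul_assoc, mul_smul_comm, Complex.star_def, Complex.conj_I] at h0 ha h1 h2
  rw [h0, ha] at h1 h2
  have h3 : f (star a) = - f a := by
    rw [eq_neg_iff_add_eq_zero]
    simpa [add_comm] using h1
  rw [h3] at h2
  have h4 : (2 * Complex.I) • f a = 0 := by
    rw [← h2]
    module
  simpa using h4

end Decomposition

/-! ### Embedding into and compression to a corner -/

section Corner

variable {A : Type*} [Ring A] [StarRing A] [Algebra ℂ A] [StarModule ℂ A]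

theorem EqZeroAt.map_single {p : CStarSeminorm A} {n m : ℕ} (i : Fin n)
    {a : Matrix (Fin m) (Fin m) A} (h : EqZeroAt (p.matrix m) a) :
    EqZeroAt ((p.matrix n).matrix m) (a.map (Matrix.single i i)) := by
  refine (p.matrix n).matrix_eq_zero_iff.mpr fun s t => p.matrix_eq_zero_iff.mpr fun k l => ?_
  rw [Matrix.map_apply, Matrix.single_apply]
  split_ifs
  · exact p.matrix_eq_zero_iff.mp h s t
  · exact map_zero p.toSeminorm

theorem PosAt.map_single {p : CStarSeminorm A} {n m : ℕ} (i : Fin n)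
    {a : Matrix (Fin m) (Fin m) A} (h : PosAt (p.matrix m) a) :
    PosAt ((p.matrix n).matrix m) (a.map (Matrix.single i i)) := by
  obtain ⟨b, c, rfl, hc⟩ := h
  refine ⟨b.map (Matrix.single i i), c.map (Matrix.single i i), ?_, hc.map_single i⟩
  ext1 s t
  have hsum : (Matrix.single i i (∑ r, star (b r s) * b r t) : Matrix (Fin n) (Fin n) A) =
      ∑ r, Matrix.single i i (star (b r s) * b r t) :=
    map_sum (Matrix.singleAddMonoidHom i i) _ _
  simp [Matrix.mul_apply, Matrix.star_eq_conjTranspose, Matrix.single_add, hsum]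

theorem EqZeroAt.map_apply {p : CStarSeminorm A} {n m : ℕ} (i : Fin n)
    {x : Matrix (Fin m) (Fin m) (Matrix (Fin n) (Fin n) A)}
    (h : EqZeroAt ((p.matrix n).matrix m) x) :
    EqZeroAt (p.matrix m) (x.map fun y => y i i) :=
  p.matrix_eq_zero_iff.mpr fun s t =>
    p.matrix_eq_zero_iff.mp ((p.matrix n).matrix_eq_zero_iff.mp h s t) i i

/-- Compression of a positive element of `M_m(M_n(B))` to the corner `M_m(B ⊗ e_ii)`. -/
theorem PosAt.map_apply [UniformSpace A] [IsUniformAddGroup A] {Λ : Type*}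
    {p : Λ → CStarSeminorm A} (hA : IsLocallyCStarAlgebra p) {d : Λ} {n m : ℕ} (i : Fin n)
    {x : Matrix (Fin m) (Fin m) (Matrix (Fin n) (Fin n) A)}
    (h : PosAt (((p d).matrix n).matrix m) x) :
    PosAt ((p d).matrix m) (x.map fun y => y i i) := by
  obtain ⟨b, c, rfl, hc⟩ := h
  -- The (i, i) corner of b*b is the sum over r of the squares of the matrices [(b_st)_ri].
  convert (hA.posAt_sum_star_mul_self d Finset.univ
    fun r : Fin n => b.map fun y => y r i).add_eqZeroAt (hc.map_apply i) using 1
  ext s t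
  simp only [Matrix.map_apply, Matrix.add_apply, Matrix.mul_apply, Matrix.sum_apply,
    Matrix.star_apply]
  rw [Finset.sum_comm]

end Corner

end LocallyCStar

theorem mainTheorem2
    {A : Type*} [Ring A] [StarRing A] [Algebra ℂ A] [StarModule ℂ A]
    [UniformSpace A] [IsUniformAddGroup A]
    {B : Type*} [Ring B] [StarRing B] [Algebra ℂ B] [StarModule ℂ B]
    [UniformSpace B] [IsUniformAddGroup B]
    {Λ Δ : Type*}
    (p : Λ → LocallyCStar.CStarSeminorm A) (q : Δ → LocallyCStar.CStarSeminorm B)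
    (hA : LocallyCStar.IsLocallyCStarAlgebra p) (hB : LocallyCStar.IsLocallyCStarAlgebra q)
    (φ : A →ₗ[ℂ] B)
    (h : ∃ n : ℕ, 2 ≤ n ∧
      LocallyCStar.IsLocalDecomposable (fun l => (p l).matrix n) (fun d => (q d).matrix n)
        (LocallyCStar.tensorId φ n)) :
    LocallyCStar.IsLocalCP p q φ := by
  obtain ⟨n, hn, φ₁, φ₂, h₁, h₂, hφ⟩ := h
  intro d
  obtain ⟨l, hl⟩ := h₁ d
  let i₀ : Fin n := ⟨0, by omega⟩
  let i₁ : Fin n := ⟨1, by omega⟩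
  have hi : i₀ ≠ i₁ := by simp [i₀, i₁]
  have hvanish (a : A) : q d (φ₂ (Matrix.single i₀ i₀ a) i₀ i₀) = 0 := by
    rw [← LocallyCStar.CStarSeminorm.toQuot_eq_zero_iff]
    let f : A →ₗ[ℂ] (q d).QuotAlg := (q d).toQuot.toLinearMap ∘ₗ
      Matrix.entryLinearMap ℂ B i₀ i₀ ∘ₗ φ₂ ∘ₗ Matrix.singleLinearMap ℂ i₀ i₀
    have hf : f = 0 := LocallyCStar.linearMap_eq_zero_of_star_mul_self fun b =>
      LocallyCStar.toQuot_copositive_single_star_mul_self h₁ h₂ hφ d hi b i₀ i₀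
    exact LinearMap.congr_fun hf a
  -- The index belonging to φ₁ suffices, because the corner of φ₂ is null at `d` for every `a`.
  refine ⟨l, fun m a => ?_⟩
  have hcorner : a.map φ = ((a.map (Matrix.single i₀ i₀)).map φ₁).map (fun y => y i₀ i₀) +
      ((a.map (Matrix.single i₀ i₀)).map φ₂).map (fun y => y i₀ i₀) := by
    ext s t
    simp only [Matrix.map_apply, Matrix.add_apply]
    rw [← Matrix.add_apply, ← LinearMap.add_apply, ← hφ, LocallyCStar.tensorId_apply]
    simp
  have hnull : LocallyCStar.EqZeroAt ((q d).matrix m)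
      (((a.map (Matrix.single i₀ i₀)).map φ₂).map fun y => y i₀ i₀) :=
    (q d).matrix_eq_zero_iff.mpr fun s t => hvanish (a s t)
  rw [hcorner]
  exact ⟨fun ha => (((hl m _).1 (ha.map_single i₀)).map_apply hB i₀).add_eqZeroAt hnull,
    fun ha => (((hl m _).2 (ha.map_single i₀)).map_apply i₀).add hnull⟩
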